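/- Let $\mathbb{H}$ be the real quaternion algebra, and let $r(M)$ denote the rank of a quaternion matrix $M$, i.e. the maximal number of right linearly independent columns of $M$. Let $A\in\mathbb{H}^{m\times n}$, $B\in\mathbb{H}^{m\times p_1}$, $C\in\mathbb{H}^{m\times p_2}$, $D\in\mathbb{H}^{m\times p_3}$, $E\in\mathbb{H}^{q_1\times n}$, $F\in\mathbb{H}^{q_2\times n}$, $G\in\mathbb{H}^{q_3\times n}$ be given. Assume that the equation $$BX+WE+CYF+DZG=A \qquad (*)$$ in the unknowns $X\in\mathbb{H}^{p_1\times n}$, $W\in\mathbb{H}^{m\times q_1}$, $Y\in\mathbb{H}^{p_2\times q_2}$, $Z\in\mathbb{H}^{p_3\times q_3}$ is consistent. Then, where the maxima and minima are taken over all solutions $(X,W,Y,Z)$ of $(*)$ and are attained, $$\max r(Y)=\min\Big\{p_2,\ q_2,\ p_2+q_2+r\begin{pmatrix}A&B\\E&0\\G&0\end{pmatrix}-r\begin{pmatrix}E\\F\\G\end{pmatrix}-r(B,\,C),\ p_2+q_2+r\begin{pmatrix}A&B&D\\E&0&0\end{pmatrix}-r\begin{pmatrix}E\\F\end{pmatrix}-r(B,\,C,\,D)\Big\},$$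 $$\min r(Y)=r\begin{pmatrix}A&B\\E&0\\G&0\end{pmatrix}+r\begin{pmatrix}A&B&D\\E&0&0\end{pmatrix}-r\begin{pmatrix}A&B&D\\E&0&0\\G&0&0\end{pmatrix}-r(B)-r(E),$$ $$\max r(Z)=\min\Big\{p_3,\ q_3,\ p_3+q_3+r\begin{pmatrix}A&B\\E&0\\F&0\end{pmatrix}-r\begin{pmatrix}E\\F\\G\end{pmatrix}-r(B,\,D),\ p_3+q_3+r\begin{pmatrix}A&B&C\\E&0&0\end{pmatrix}-r\begin{pmatrix}E\\G\end{pmatrix}-r(B,\,C,\,D)\Big\},$$ $$\min r(Z)=r\begin{pmatrix}A&B\\E&0\\F&0\end{pmatrix}+r\begin{pmatrix}A&B&C\\E&0&0\end{pmatrix}-r\begin{pmatrix}A&B&C\\E&0&0\\F&0&0\end{pmatrix}-r(B)-r(E).$$ -/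

import Mathlib

open scoped Quaternion

/-- The rank of a matrix over the real quaternions: the dimension, as a right vector space over the
quaternions, of the right span of its columns. (Right scalar multiplication is the action of the
opposite ring.) Equivalently, the maximal number of right linearly independent columns. -/
noncomputable def qrank {ι κ : Type*} (M : Matrix ι κ ℍ[ℝ]) : ℕ :=
  Module.finrank ℍ[ℝ]ᵐᵒᵖ (Submodule.span ℍ[ℝ]ᵐᵒᵖ (Set.range M.col))

/-- The equation `B X + W E + C Y F + D Z G = A` over the real quaternions. -/
def IsSolution {m n p₁ p₂ p₃ q₁ q₂ q₃ : ℕ}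
    (A : Matrix (Fin m) (Fin n) ℍ[ℝ]) (B : Matrix (Fin m) (Fin p₁) ℍ[ℝ])
    (C : Matrix (Fin m) (Fin p₂) ℍ[ℝ]) (D : Matrix (Fin m) (Fin p₃) ℍ[ℝ])
    (E : Matrix (Fin q₁) (Fin n) ℍ[ℝ]) (F : Matrix (Fin q₂) (Fin n) ℍ[ℝ])
    (G : Matrix (Fin q₃) (Fin n) ℍ[ℝ])
    (X : Matrix (Fin p₁) (Fin n) ℍ[ℝ]) (W : Matrix (Fin m) (Fin q₁) ℍ[ℝ])
    (Y : Matrix (Fin p₂) (Fin q₂) ℍ[ℝ]) (Z : Matrix (Fin p₃) (Fin q₃) ℍ[ℝ]) : Prop :=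
  B * X + W * E + C * Y * F + D * Z * G = A

/-- The set of ranks of the matrices `Y` occurring in solutions `(X, W, Y, Z)`. -/
def ranksY {m n p₁ p₂ p₃ q₁ q₂ q₃ : ℕ}
    (A : Matrix (Fin m) (Fin n) ℍ[ℝ]) (B : Matrix (Fin m) (Fin p₁) ℍ[ℝ])
    (C : Matrix (Fin m) (Fin p₂) ℍ[ℝ]) (D : Matrix (Fin m) (Fin p₃) ℍ[ℝ])
    (E : Matrix (Fin q₁) (Fin n) ℍ[ℝ]) (F : Matrix (Fin q₂) (Fin n) ℍ[ℝ])
    (G : Matrix (Fin q₃) (Fin n) ℍ[ℝ]) : Set ℤ :=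
  {r | ∃ X W Y Z, IsSolution A B C D E F G X W Y Z ∧ r = (qrank Y : ℤ)}

/-- The set of ranks of the matrices `Z` occurring in solutions `(X, W, Y, Z)`. -/
def ranksZ {m n p₁ p₂ p₃ q₁ q₂ q₃ : ℕ}
    (A : Matrix (Fin m) (Fin n) ℍ[ℝ]) (B : Matrix (Fin m) (Fin p₁) ℍ[ℝ])
    (C : Matrix (Fin m) (Fin p₂) ℍ[ℝ]) (D : Matrix (Fin m) (Fin p₃) ℍ[ℝ])
    (E : Matrix (Fin q₁) (Fin n) ℍ[ℝ]) (F : Matrix (Fin q₂) (Fin n) ℍ[ℝ])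
    (G : Matrix (Fin q₃) (Fin n) ℍ[ℝ]) : Set ℤ :=
  {r | ∃ X W Y Z, IsSolution A B C D E F G X W Y Z ∧ r = (qrank Z : ℤ)}

/-- The block matrix `(M₁ M₂)`. -/
abbrev row2 {ι κ₁ κ₂ : Type*} (M₁ : Matrix ι κ₁ ℍ[ℝ]) (M₂ : Matrix ι κ₂ ℍ[ℝ]) :
    Matrix ι (κ₁ ⊕ κ₂) ℍ[ℝ] :=
  Matrix.fromCols M₁ M₂

/-- The block matrix `(M₁ M₂ M₃)`. -/
abbrev row3 {ι κ₁ κ₂ κ₃ : Type*} (M₁ : Matrix ι κ₁ ℍ[ℝ]) (M₂ : Matrix ι κ₂ ℍ[ℝ])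
    (M₃ : Matrix ι κ₃ ℍ[ℝ]) : Matrix ι (κ₁ ⊕ κ₂ ⊕ κ₃) ℍ[ℝ] :=
  Matrix.fromCols M₁ (Matrix.fromCols M₂ M₃)

/-- The block matrix with `M₁` stacked above `M₂`. -/
abbrev stack2 {ι₁ ι₂ κ : Type*} (M₁ : Matrix ι₁ κ ℍ[ℝ]) (M₂ : Matrix ι₂ κ ℍ[ℝ]) :
    Matrix (ι₁ ⊕ ι₂) κ ℍ[ℝ] :=
  Matrix.fromRows M₁ M₂

/-- The block matrix with `M₁`, `M₂`, `M₃` stacked in this order from top to bottom. -/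
abbrev stack3 {ι₁ ι₂ ι₃ κ : Type*} (M₁ : Matrix ι₁ κ ℍ[ℝ]) (M₂ : Matrix ι₂ κ ℍ[ℝ])
    (M₃ : Matrix ι₃ κ ℍ[ℝ]) : Matrix (ι₁ ⊕ ι₂ ⊕ ι₃) κ ℍ[ℝ] :=
  Matrix.fromRows M₁ (Matrix.fromRows M₂ M₃)

/-! ### Extremal ranks of a linear map prescribed modulo nested subspaces. -/

section CompletionRank

set_option linter.unusedSectionVars false

open Module Submodule

variable {K V W U : Type*} [DivisionRing K] [AddCommGroup V] [Module K V]
  [AddCommGroup W] [Module K W] [AddCommGroup U] [Module K U]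

/-! For fixed `Y`, the unknowns `X`, `W`, `Z` can be eliminated: a solution exists iff `A - CYF`
maps `ker E ⊓ ker G` into `im B` and `ker E` into `im B + im D`. Relative to one solution `Y₀`, this
says that `Y` agrees with `Y₀` modulo `T₁` on `S₁` and modulo `T₂` on `S₂`, where `S₁ = F(ker E ⊓
ker G) ≤ S₂ = F(ker E)` and `T₁ = C⁻¹(im B) ≤ T₂ = C⁻¹(im B + im D)`.

What remains is a completion problem over a division ring. The minimal rank comes from a dimension
count (`IsCompletion.add_le_finrank_range`) and a completion whose range is just large enough
(`exists_isCompletion_finrank_range_le`). For the maximum, rank-one perturbations show that a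
completion of maximal rank is surjective, injective, or attains one of the two bounds of
`finrank_range_add_le_of_forall_sub_mem`; this is `IsMaxCompletion.finrank_range_cases`.

The dimensions of the `Sᵢ`, `Tᵢ` and `Y₀(Sᵢ) + Tⱼ` are then read off from ranks of block matrices.
The formulas for `Z` follow from the symmetry of the equation. -/

theorem LinearMap.exists_comp_eq_of_range_le (f : V →ₗ[K] W) (g : U →ₗ[K] W)
    (h : LinearMap.range f ≤ LinearMap.range g) : ∃ k : V →ₗ[K] U, g ∘ₗ k = f := by
  obtain ⟨k, hk⟩ := Module.projective_lifting_property g.rangeRestrict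
    (f.codRestrict (LinearMap.range g) fun v => h ⟨v, rfl⟩) g.surjective_rangeRestrict
  refine ⟨k, LinearMap.ext fun v => ?_⟩
  simpa using congr(($hk v : W))

theorem LinearMap.exists_comp_eq_of_ker_le (f : V →ₗ[K] W) (g : V →ₗ[K] U)
    (h : LinearMap.ker g ≤ LinearMap.ker f) : ∃ k : U →ₗ[K] W, k ∘ₗ g = f := by
  obtain ⟨s, hs⟩ := g.rangeRestrict.exists_rightInverse_of_surjective g.range_rangeRestrict
  obtain ⟨k, hk⟩ := LinearMap.exists_extend (f ∘ₗ s)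
  refine ⟨k, LinearMap.ext fun v => ?_⟩
  have h1 : k (g v) = f (s (g.rangeRestrict v)) := by simpa using congr($hk (g.rangeRestrict v))
  have h2 : g (s (g.rangeRestrict v)) = g v := by
    simpa using congr((($hs (g.rangeRestrict v) : LinearMap.range g) : U))
  have h3 : s (g.rangeRestrict v) - v ∈ LinearMap.ker f := h (by simp [h2])
  rw [LinearMap.mem_ker, map_sub, sub_eq_zero] at h3
  rw [LinearMap.comp_apply, h1, h3]

theorem Submodule.exists_linearMap_retract (S : Submodule K V) :
    ∃ e : V →ₗ[K] V, (∀ v, e v ∈ S) ∧ ∀ v ∈ S, e v = v := by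
  obtain ⟨e, he⟩ := LinearMap.exists_extend (LinearMap.id : S →ₗ[K] S)
  exact ⟨S.subtype ∘ₗ e, fun v => (e v).2, fun v hv => by simpa using congr(($he ⟨v, hv⟩ : V))⟩

/-- A linear endomorphism with values in `J` that is the identity modulo `T` on `J ⊔ T`. -/
theorem Submodule.exists_linearMap_retract_mod (J T : Submodule K V) :
    ∃ e : V →ₗ[K] V, (∀ v, e v ∈ J) ∧ ∀ v ∈ J ⊔ T, e v - v ∈ T := by
  obtain ⟨r, hr, hr'⟩ := (J ⊔ T).exists_linearMap_retract
  obtain ⟨k, hk⟩ := LinearMap.exists_comp_eq_of_range_le r (J.subtype.coprod T.subtype) (by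
    rw [LinearMap.range_coprod, range_subtype, range_subtype]
    rintro _ ⟨v, rfl⟩
    exact hr v)
  refine ⟨J.subtype ∘ₗ LinearMap.fst K J T ∘ₗ k, fun v => (k v).1.2, fun v hv => ?_⟩
  have h : ((k v).1 : V) + (k v).2 = v := by simpa [hr' v hv] using congr($hk v)
  have h' : ((k v).1 : V) - v = -((k v).2 : V) := by rw [← sub_eq_zero]; nth_rw 2 [← h]; abel
  simp [h']

variable [FiniteDimensional K V] [FiniteDimensional K W]

theorem Submodule.exists_sup_eq_finrank_add {T S : Submodule K V} (h : T ≤ S) :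
    ∃ J, J ⊔ T = S ∧ finrank K J + finrank K T = finrank K S := by
  obtain ⟨c, hc⟩ := T.exists_isCompl
  have h1 : c ⊓ S ⊔ T = S := by
    rw [sup_comm, ← sup_inf_assoc_of_le c h, hc.sup_eq_top, top_inf_eq]
  refine ⟨c ⊓ S, h1, ?_⟩
  have h2 : c ⊓ S ⊓ T = ⊥ := by
    rw [inf_right_comm, inf_comm c, hc.inf_eq_bot, bot_inf_eq]
  have := finrank_sup_add_finrank_inf_eq (c ⊓ S) T
  rw [h1, h2, finrank_bot] at this
  omega

theorem Submodule.finrank_map_add_finrank_inf_ker (f : V →ₗ[K] W) (S : Submodule K V) :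
    finrank K (S.map f) + finrank K (S ⊓ LinearMap.ker f : Submodule K V) = finrank K S := by
  have h := (f.domRestrict S).finrank_range_add_finrank_ker
  rw [LinearMap.range_domRestrict, LinearMap.ker_domRestrict] at h
  rw [← h, ← Submodule.map_comap_subtype, finrank_map_subtype_eq]

/-- The map `f` induces an isomorphism from `(S + f⁻¹T) / f⁻¹T` onto `(f(S) + T) / T`. -/
theorem Submodule.finrank_map_sup_add_finrank_comap (f : V →ₗ[K] W) (S : Submodule K V)
    (T : Submodule K W) :
    finrank K (S.map f ⊔ T : Submodule K W) + finrank K (T.comap f) =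
      finrank K (S ⊔ T.comap f : Submodule K V) + finrank K T := by
  have hk : LinearMap.ker f ≤ T.comap f := LinearMap.ker_le_comap f
  have h1 := finrank_map_add_finrank_inf_ker f (S ⊔ T.comap f)
  have h2 := finrank_map_add_finrank_inf_ker f (T.comap f)
  rw [inf_eq_right.2 (hk.trans le_sup_right)] at h1
  rw [inf_eq_right.2 hk] at h2
  have h3 := finrank_sup_add_finrank_inf_eq ((S ⊔ T.comap f).map f) T
  have h4 : (S ⊔ T.comap f).map f ⊔ T = S.map f ⊔ T := by
    rw [map_sup, sup_assoc, sup_eq_right.2 (map_comap_le f T)]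
  have h5 : (S ⊔ T.comap f).map f ⊓ T = (T.comap f).map f := by
    refine le_antisymm ?_ (le_inf (map_mono le_sup_right) (map_comap_le f T))
    rintro _ ⟨⟨v, -, rfl⟩, hv⟩
    exact ⟨v, hv, rfl⟩
  rw [h4, h5] at h3
  omega

/-- The linear maps that agree with `Y₀` modulo `T₁` on `S₁` and modulo `T₂` on `S₂`. -/
def IsCompletion (Y₀ : V →ₗ[K] W) (S₁ S₂ : Submodule K V) (T₁ T₂ : Submodule K W)
    (Y : V →ₗ[K] W) : Prop :=
  (∀ v ∈ S₁, Y v - Y₀ v ∈ T₁) ∧ ∀ v ∈ S₂, Y v - Y₀ v ∈ T₂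

variable {Y₀ Y : V →ₗ[K] W} {S₁ S₂ : Submodule K V} {T₁ T₂ : Submodule K W}

theorem map_sup_eq_of_forall_sub_mem {S : Submodule K V} {T : Submodule K W}
    (h : ∀ v ∈ S, Y v - Y₀ v ∈ T) : S.map Y ⊔ T = S.map Y₀ ⊔ T := by
  refine le_antisymm (sup_le ?_ le_sup_right) (sup_le ?_ le_sup_right)
  · rintro _ ⟨v, hv, rfl⟩
    rw [← add_sub_cancel (Y₀ v) (Y v)]
    exact add_mem (mem_sup_left ⟨v, hv, rfl⟩) (mem_sup_right (h v hv))
  · rintro _ ⟨v, hv, rfl⟩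
    rw [← sub_sub_cancel (Y v) (Y₀ v)]
    exact sub_mem (mem_sup_left ⟨v, hv, rfl⟩) (mem_sup_right (h v hv))

/-- The three sums do not change when `Y₀` is replaced by `Y`. Then `rank Y ≥ dim Y(S₂)`, and the
part of `Y(S₂)` inside `T₂` is at least `Y(S₁) ⊓ T₂`. -/
theorem IsCompletion.add_le_finrank_range (hS : S₁ ≤ S₂)
    (hY : IsCompletion Y₀ S₁ S₂ T₁ T₂ Y) :
    finrank K (S₁.map Y₀ ⊔ T₁ : Submodule K W) + finrank K (S₂.map Y₀ ⊔ T₂ : Submodule K W) ≤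
      finrank K (LinearMap.range Y) + finrank K T₁ +
        finrank K (S₁.map Y₀ ⊔ T₂ : Submodule K W) := by
  rw [← map_sup_eq_of_forall_sub_mem hY.1, ← map_sup_eq_of_forall_sub_mem hY.2,
    ← map_sup_eq_of_forall_sub_mem fun v hv => hY.2 v (hS hv)]
  have h1 := finrank_sup_add_finrank_inf_eq (S₁.map Y) T₁
  have h2 := finrank_sup_add_finrank_inf_eq (S₂.map Y) T₂
  have h3 := finrank_sup_add_finrank_inf_eq (S₁.map Y) T₂
  have h4 : finrank K (S₂.map Y) ≤ finrank K (LinearMap.range Y) :=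
    finrank_mono LinearMap.map_le_range
  have h5 : finrank K (S₁.map Y ⊓ T₂ : Submodule K W) ≤
      finrank K (S₂.map Y ⊓ T₂ : Submodule K W) :=
    finrank_mono (inf_le_inf_right _ (map_mono hS))
  omega

theorem exists_isCompletion_finrank_range_le (Y₀ : V →ₗ[K] W) (hS : S₁ ≤ S₂) (hT : T₁ ≤ T₂) :
    ∃ Y, IsCompletion Y₀ S₁ S₂ T₁ T₂ Y ∧
      finrank K (LinearMap.range Y) + finrank K T₁ +
        finrank K (S₁.map Y₀ ⊔ T₂ : Submodule K W) ≤
      finrank K (S₁.map Y₀ ⊔ T₁ : Submodule K W) +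
        finrank K (S₂.map Y₀ ⊔ T₂ : Submodule K W) := by
  -- The dimensions of `J₁` and `J₂` add up to the required rank, so it suffices to find a
  -- completion with range in `J₁ ⊔ J₂`.
  obtain ⟨J₁, hJ₁, hd₁⟩ := exists_sup_eq_finrank_add (le_sup_right : T₁ ≤ S₁.map Y₀ ⊔ T₁)
  obtain ⟨J₂, hJ₂, hd₂⟩ := exists_sup_eq_finrank_add
    (sup_le_sup_right (map_mono hS) T₂ : S₁.map Y₀ ⊔ T₂ ≤ S₂.map Y₀ ⊔ T₂)
  obtain ⟨e₁, he₁, he₁'⟩ := S₁.exists_linearMap_retract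
  obtain ⟨e₂, he₂, he₂'⟩ := S₂.exists_linearMap_retract
  obtain ⟨π₁, hπ₁, hπ₁'⟩ := exists_linearMap_retract_mod J₁ T₁
  obtain ⟨π₂, hπ₂, hπ₂'⟩ := exists_linearMap_retract_mod (J₁ ⊔ J₂) T₂
  have hJ : S₂.map Y₀ ≤ J₁ ⊔ J₂ ⊔ T₂ := by
    have h1 : S₁.map Y₀ ≤ J₁ ⊔ T₁ := hJ₁ ▸ le_sup_left
    have h2 : S₂.map Y₀ ≤ J₂ ⊔ (S₁.map Y₀ ⊔ T₂) := hJ₂ ▸ le_sup_left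
    refine h2.trans (sup_le (le_sup_right.trans le_sup_left) (sup_le (h1.trans ?_) le_sup_right))
    exact sup_le (le_sup_left.trans le_sup_left) (hT.trans le_sup_right)
  -- The first term corrects `Y₀` modulo `T₁` on `S₁`. The second vanishes on `S₁`, where `e₁` and
  -- `e₂` agree, and handles the rest of `S₂` modulo `T₂`.
  refine ⟨π₁ ∘ₗ Y₀ ∘ₗ e₁ + π₂ ∘ₗ Y₀ ∘ₗ (e₂ - e₁), ⟨fun v hv => ?_, fun v hv => ?_⟩, ?_⟩
  · simpa [he₁' v hv, he₂' v (hS hv)] using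
      hπ₁' (Y₀ v) (hJ₁ ▸ mem_sup_left (mem_map_of_mem hv))
  · have h1 := hT (hπ₁' (Y₀ (e₁ v)) (hJ₁ ▸ mem_sup_left (mem_map_of_mem (he₁ v))))
    have h2 := hπ₂' (Y₀ (v - e₁ v)) (hJ (mem_map_of_mem (sub_mem hv (hS (he₁ v)))))
    convert add_mem h1 h2 using 1
    simp [he₂' v hv]
    abel
  · have h1 : LinearMap.range (π₁ ∘ₗ Y₀ ∘ₗ e₁ + π₂ ∘ₗ Y₀ ∘ₗ (e₂ - e₁)) ≤ J₁ ⊔ J₂ := by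
      rintro _ ⟨v, rfl⟩
      exact add_mem (mem_sup_left (hπ₁ _)) (hπ₂ _)
    have h2 := finrank_mono h1
    have h3 := finrank_sup_add_finrank_inf_eq J₁ J₂
    omega

theorem finrank_range_add_le_of_forall_sub_mem {S : Submodule K V} {T : Submodule K W}
    (h : ∀ v ∈ S, Y v - Y₀ v ∈ T) :
    finrank K (LinearMap.range Y) + finrank K S ≤
      finrank K V + finrank K (S.map Y₀ ⊔ T : Submodule K W) := by
  rw [← map_sup_eq_of_forall_sub_mem h]
  have h1 := Y.finrank_range_add_finrank_ker
  have h2 := finrank_map_add_finrank_inf_ker Y S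
  have h3 : finrank K (S ⊓ LinearMap.ker Y : Submodule K V) ≤ finrank K (LinearMap.ker Y) :=
    finrank_mono inf_le_right
  have h4 : finrank K (S.map Y) ≤ finrank K (S.map Y ⊔ T : Submodule K W) :=
    finrank_mono le_sup_left
  omega

/-- The two extra hypotheses are the equality cases of the two estimates behind the preceding upper
bound. -/
theorem finrank_range_add_eq_of_ker_le {S : Submodule K V} {T : Submodule K W}
    (h : ∀ v ∈ S, Y v - Y₀ v ∈ T) (hk : LinearMap.ker Y ≤ S) (hT : T ≤ S.map Y) :
    finrank K (LinearMap.range Y) + finrank K S =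
      finrank K V + finrank K (S.map Y₀ ⊔ T : Submodule K W) := by
  rw [← map_sup_eq_of_forall_sub_mem h, sup_eq_left.2 hT]
  have h1 := Y.finrank_range_add_finrank_ker
  have h2 := finrank_map_add_finrank_inf_ker Y S
  rw [inf_eq_right.2 hk] at h2
  omega

/-- The perturbed map sends `k` to `t` and `v - φ v • k` to `Y v`. Hence a rank-one perturbation
along a kernel vector never loses range. -/
theorem range_sup_span_le_range_add_smulRight {k : V} (hk : Y k = 0) {φ : V →ₗ[K] K}
    (hφ : φ k = 1) (t : W) :
    LinearMap.range Y ⊔ span K {t} ≤ LinearMap.range (Y + φ.smulRight t) := by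
  refine sup_le ?_ ((span_singleton_le_iff_mem _ _).2 ⟨k, by simp [hk, hφ]⟩)
  rintro _ ⟨v, rfl⟩
  exact ⟨v - φ v • k, by simp [hk, hφ]⟩

theorem IsCompletion.add_smulRight (hY : IsCompletion Y₀ S₁ S₂ T₁ T₂ Y) {φ : V →ₗ[K] K} {t : W}
    (h₁ : ∀ v ∈ S₁, φ v • t ∈ T₁) (h₂ : ∀ v ∈ S₂, φ v • t ∈ T₂) :
    IsCompletion Y₀ S₁ S₂ T₁ T₂ (Y + φ.smulRight t) := by
  refine ⟨fun v hv => ?_, fun v hv => ?_⟩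
  · simpa [add_sub_right_comm] using add_mem (hY.1 v hv) (h₁ v hv)
  · simpa [add_sub_right_comm] using add_mem (hY.2 v hv) (h₂ v hv)

/-- A completion of maximal rank. -/
def IsMaxCompletion (Y₀ : V →ₗ[K] W) (S₁ S₂ : Submodule K V) (T₁ T₂ : Submodule K W)
    (Y : V →ₗ[K] W) : Prop :=
  IsCompletion Y₀ S₁ S₂ T₁ T₂ Y ∧ ∀ Y', IsCompletion Y₀ S₁ S₂ T₁ T₂ Y' →
    finrank K (LinearMap.range Y') ≤ finrank K (LinearMap.range Y)

theorem IsMaxCompletion.mem_range (hY : IsMaxCompletion Y₀ S₁ S₂ T₁ T₂ Y) {k : V} (hk : Y k = 0)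
    {φ : V →ₗ[K] K} (hφ : φ k = 1) {t : W} (h₁ : ∀ v ∈ S₁, φ v • t ∈ T₁)
    (h₂ : ∀ v ∈ S₂, φ v • t ∈ T₂) : t ∈ LinearMap.range Y := by
  have h := range_sup_span_le_range_add_smulRight hk hφ t
  have h' := eq_of_le_of_finrank_le (le_sup_left.trans h) (hY.2 _ (hY.1.add_smulRight h₁ h₂))
  exact h'.ge (h (mem_sup_right (mem_span_singleton_self t)))

theorem IsMaxCompletion.add_smulRight (hY : IsMaxCompletion Y₀ S₁ S₂ T₁ T₂ Y) {k : V}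
    (hk : Y k = 0) {φ : V →ₗ[K] K} (hφ : φ k = 1) {t : W} (h₁ : ∀ v ∈ S₁, φ v • t ∈ T₁)
    (h₂ : ∀ v ∈ S₂, φ v • t ∈ T₂) : IsMaxCompletion Y₀ S₁ S₂ T₁ T₂ (Y + φ.smulRight t) :=
  ⟨hY.1.add_smulRight h₁ h₂, fun Y' hY' => (hY.2 Y' hY').trans
    (finrank_mono (le_sup_left.trans (range_sup_span_le_range_add_smulRight hk hφ t)))⟩

theorem exists_dual_eq_one_of_notMem {S : Submodule K V} {k : V} (hk : k ∉ S) :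
    ∃ φ : V →ₗ[K] K, (∀ v ∈ S, φ v = 0) ∧ φ k = 1 := by
  obtain ⟨φ, h, hφ⟩ := LinearMap.exists_extend_of_notMem (0 : S →ₗ[K] K) hk 1
  exact ⟨φ, fun v hv => by simpa using congr($h ⟨v, hv⟩), hφ⟩

theorem exists_dual_eq_one_eq_neg_one {S S' : Submodule K V} {k u : V} (hk : k ∉ S)
    (hk' : k ∈ S') (hS : S ≤ S') (hu : u ∉ S') :
    ∃ φ : V →ₗ[K] K, (∀ v ∈ S, φ v = 0) ∧ φ k = 1 ∧ φ u = -1 := by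
  obtain ⟨φ, h, hφ⟩ := exists_dual_eq_one_of_notMem hk
  obtain ⟨ψ, h', hψ⟩ := LinearMap.exists_extend_of_notMem (φ.domRestrict S') hu (-1)
  have h'' : ∀ v ∈ S', ψ v = φ v := fun v hv => by simpa using congr($h' ⟨v, hv⟩)
  exact ⟨ψ, fun v hv => by rw [h'' v (hS hv), h v hv], by rw [h'' k hk', hφ], hψ⟩

theorem exists_isMaxCompletion (Y₀ : V →ₗ[K] W) (S₁ S₂ : Submodule K V) (T₁ T₂ : Submodule K W) :
    ∃ Y, IsMaxCompletion Y₀ S₁ S₂ T₁ T₂ Y := by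
  let R : Set ℕ := {r | ∃ Y, IsCompletion Y₀ S₁ S₂ T₁ T₂ Y ∧ finrank K (LinearMap.range Y) = r}
  have hne : R.Nonempty := ⟨_, Y₀, ⟨by simp, by simp⟩, rfl⟩
  have hbdd : BddAbove R := ⟨finrank K W, by rintro _ ⟨Y, -, rfl⟩; exact Submodule.finrank_le _⟩
  obtain ⟨Y, hY, hr⟩ := Nat.sSup_mem hne hbdd
  exact ⟨Y, hY, fun Y' hY' => hr ▸ le_csSup hbdd ⟨Y', hY', rfl⟩⟩

/-- A kernel vector outside `S₂` could be sent anywhere by a perturbation vanishing on `S₂`, so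
maximality would force surjectivity. -/
theorem IsMaxCompletion.ker_le (hY : IsMaxCompletion Y₀ S₁ S₂ T₁ T₂ Y) (hS : S₁ ≤ S₂)
    (hr : LinearMap.range Y ≠ ⊤) : LinearMap.ker Y ≤ S₂ := by
  intro k hk
  by_contra hkS
  obtain ⟨φ, h0, h1⟩ := exists_dual_eq_one_of_notMem hkS
  refine hr (eq_top_iff.2 fun t _ => hY.mem_range hk h1 (fun v hv => ?_) fun v hv => ?_)
  · simp [h0 v (hS hv)]
  · simp [h0 v hv]

theorem IsMaxCompletion.eq_of_not_ker_le (hY : IsMaxCompletion Y₀ S₁ S₂ T₁ T₂ Y) (hS : S₁ ≤ S₂)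
    (hr : finrank K (LinearMap.range Y) ≠ finrank K W) (hk : ¬ LinearMap.ker Y ≤ S₁) :
    finrank K (LinearMap.range Y) + finrank K S₂ =
      finrank K V + finrank K (S₂.map Y₀ ⊔ T₂ : Submodule K W) := by
  have hker := hY.ker_le hS fun h => hr (by rw [h, finrank_top])
  obtain ⟨k, hk0, hkS⟩ := SetLike.not_le_iff_exists.1 hk
  refine finrank_range_add_eq_of_ker_le hY.1.2 hker ?_
  have hT : T₂ ≤ LinearMap.range Y := by
    intro t ht
    obtain ⟨φ, h0, h1⟩ := exists_dual_eq_one_of_notMem hkS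
    exact hY.mem_range hk0 h1 (fun v hv => by simp [h0 v hv]) fun v hv => T₂.smul_mem _ ht
  intro t ht
  obtain ⟨u, rfl⟩ := hT ht
  by_contra hu
  -- The value `-1` at `u` makes the perturbation by `φ.smulRight (Y u)` kill `u`. The new map is
  -- still maximal, yet its kernel leaves `S₂`, a contradiction.
  obtain ⟨φ, h0, h1, hm1⟩ := exists_dual_eq_one_eq_neg_one hkS (hker hk0) hS
    fun h => hu ⟨u, h, rfl⟩
  have hY' := hY.add_smulRight hk0 h1 (t := Y u) (fun v hv => by simp [h0 v hv])
    fun v _ => T₂.smul_mem _ ht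
  have hle : finrank K (LinearMap.range (Y + φ.smulRight (Y u))) ≤
    finrank K (LinearMap.range Y) := hY.2 _ hY'.1
  have hlt := lt_of_le_of_ne (Submodule.finrank_le (LinearMap.range Y)) hr
  have := hY'.ker_le hS fun h => by rw [h, finrank_top] at hle; omega
  exact hu ⟨u, this (by simp [hm1]), rfl⟩

theorem IsMaxCompletion.finrank_range_cases (hY : IsMaxCompletion Y₀ S₁ S₂ T₁ T₂ Y)
    (hS : S₁ ≤ S₂) (hT : T₁ ≤ T₂) :
    finrank K (LinearMap.range Y) = finrank K W ∨ finrank K (LinearMap.range Y) = finrank K V ∨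
    finrank K (LinearMap.range Y) + finrank K S₁ =
      finrank K V + finrank K (S₁.map Y₀ ⊔ T₁ : Submodule K W) ∨
    finrank K (LinearMap.range Y) + finrank K S₂ =
      finrank K V + finrank K (S₂.map Y₀ ⊔ T₂ : Submodule K W) := by
  by_cases hW : finrank K (LinearMap.range Y) = finrank K W
  · exact .inl hW
  by_cases hk : LinearMap.ker Y ≤ S₁
  swap
  · exact .inr (.inr (.inr (hY.eq_of_not_ker_le hS hW hk)))
  by_cases hk0 : LinearMap.ker Y = ⊥
  · have := Y.finrank_range_add_finrank_ker
    rw [hk0, finrank_bot] at this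
    exact .inr (.inl this)
  obtain ⟨k, hk0, hkne⟩ := Submodule.exists_mem_ne_zero_of_ne_bot hk0
  have hkne : k ∉ (⊥ : Submodule K V) := hkne
  by_cases hTS : T₁ ≤ S₁.map Y
  · exact .inr (.inr (.inl (finrank_range_add_eq_of_ker_le hY.1.1 hk hTS)))
  obtain ⟨t, ht, htS⟩ := SetLike.not_le_iff_exists.1 hTS
  obtain ⟨u, rfl⟩ : t ∈ LinearMap.range Y := by
    obtain ⟨φ, h0, h1⟩ := exists_dual_eq_one_of_notMem hkne
    exact hY.mem_range hk0 h1 (fun v hv => T₁.smul_mem _ ht) fun v hv => T₂.smul_mem _ (hT ht)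
  have huS : u ∉ S₁ := fun h => htS ⟨u, h, rfl⟩
  -- Since `Y u ∈ T₁ ≤ T₂`, `φ` need not vanish on `S₁`. The perturbed map has the same rank but
  -- kills `u ∉ S₁`, which reduces to the case of a kernel not inside `S₁`.
  obtain ⟨φ, -, h1, hm1⟩ := exists_dual_eq_one_eq_neg_one hkne (hk hk0) bot_le huS
  have hY' := hY.add_smulRight hk0 h1 (t := Y u) (fun v _ => T₁.smul_mem _ ht)
    fun v _ => T₂.smul_mem _ (hT ht)
  have heq := le_antisymm (hY.2 _ hY'.1) (hY'.2 _ hY.1)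
  have := hY'.eq_of_not_ker_le hS (heq ▸ hW) fun h => huS (h (by simp [hm1]))
  rw [heq] at this
  exact .inr (.inr (.inr this))

end CompletionRank

/-! ### Solvability of `BX + WE + DZG = A`. -/

section LinearEquation

open Module Submodule

variable {K : Type*} [DivisionRing K]

theorem exists_comp_add_comp_add_comp_eq_iff {N M P₁ Q₁ P₃ Q₃ : Type*}
    [AddCommGroup N] [Module K N] [AddCommGroup M] [Module K M]
    [AddCommGroup P₁] [Module K P₁] [AddCommGroup Q₁] [Module K Q₁]
    [AddCommGroup P₃] [Module K P₃] [AddCommGroup Q₃] [Module K Q₃]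
    (A : N →ₗ[K] M) (B : P₁ →ₗ[K] M) (D : P₃ →ₗ[K] M) (E : N →ₗ[K] Q₁) (G : N →ₗ[K] Q₃) :
    (∃ (X : N →ₗ[K] P₁) (W : Q₁ →ₗ[K] M) (Z : Q₃ →ₗ[K] P₃),
      B ∘ₗ X + W ∘ₗ E + D ∘ₗ Z ∘ₗ G = A) ↔
    (∀ v ∈ LinearMap.ker E ⊓ LinearMap.ker G, A v ∈ LinearMap.range B) ∧
      ∀ v ∈ LinearMap.ker E, A v ∈ LinearMap.range B ⊔ LinearMap.range D := by
  constructor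
  · rintro ⟨X, W, Z, rfl⟩
    refine ⟨fun v hv => ⟨X v, ?_⟩, fun v hv => ?_⟩
    · simp [LinearMap.mem_ker.1 hv.1, LinearMap.mem_ker.1 hv.2]
    · simpa [LinearMap.mem_ker.1 hv] using
        add_mem (mem_sup_left (LinearMap.mem_range_self B (X v)))
          (mem_sup_right (LinearMap.mem_range_self D (Z (G v))))
  · rintro ⟨h₁, h₂⟩
    obtain ⟨e, he, he'⟩ := (LinearMap.ker E).exists_linearMap_retract
    set q := (LinearMap.range B).mkQ
    have hq : ∀ x, q x = 0 ↔ x ∈ LinearMap.range B := fun x => Submodule.Quotient.mk_eq_zero _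
    -- Modulo `im B`, `Z` has to satisfy `DZG = A` on `ker E`. The map `k` below is uncontrolled off
    -- `G(ker E)`; composing with `r` forces its values into the range of `q ∘ₗ D`, so that it lifts
    -- to `Z`.
    obtain ⟨r, hr, hr'⟩ := (LinearMap.range (q ∘ₗ D)).exists_linearMap_retract
    obtain ⟨k, hk⟩ := LinearMap.exists_comp_eq_of_ker_le (q ∘ₗ A ∘ₗ e) (G ∘ₗ e)
      fun v hv => (hq _).2 (h₁ _ ⟨he v, hv⟩)
    obtain ⟨Z, hZ⟩ := LinearMap.exists_comp_eq_of_range_le (r ∘ₗ k) (q ∘ₗ D) (by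
      rintro _ ⟨v, rfl⟩
      exact hr _)
    have hL : LinearMap.range ((A - D ∘ₗ Z ∘ₗ G) ∘ₗ e) ≤ LinearMap.range B := by
      rintro _ ⟨v, rfl⟩
      have h3 : q (D (Z (G (e v)))) = r (k (G (e v))) := congr($hZ (G (e v)))
      have h4 : k (G (e v)) = q (A (e v)) := congr($hk v)
      have h5 : q (A (e v)) ∈ LinearMap.range (q ∘ₗ D) := by
        obtain ⟨x, hx, y, ⟨z, rfl⟩, hxy⟩ := mem_sup.1 (h₂ _ (he v))
        exact ⟨z, by rw [← hxy, map_add, (hq x).2 hx, zero_add]; rfl⟩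
      rw [← hq]
      simp [h3, h4, hr' _ h5]
    -- Split `A - DZG` along `e`: the part through `e` has values in `im B` and gives `X`; the
    -- remainder vanishes on `ker E` and gives `W`.
    obtain ⟨X, hX⟩ := LinearMap.exists_comp_eq_of_range_le _ B hL
    obtain ⟨W, hW⟩ := LinearMap.exists_comp_eq_of_ker_le
      ((A - D ∘ₗ Z ∘ₗ G) - (A - D ∘ₗ Z ∘ₗ G) ∘ₗ e) E fun v hv => by simp [he' v hv]
    exact ⟨X, W, Z, by rw [hX, hW]; abel⟩

end LinearEquation

/-! ### Quaternion matrices as right linear maps, and ranks of block matrices. -/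

section QuaternionMatrix

open Module Submodule Matrix

variable {ι ι' κ κ' : Type*} [Fintype κ] [Fintype κ']

/-- The right linear map on column vectors given by a quaternion matrix. -/
noncomputable abbrev qlin (M : Matrix ι κ ℍ[ℝ]) : (κ → ℍ[ℝ]) →ₗ[ℍ[ℝ]ᵐᵒᵖ] (ι → ℍ[ℝ]) :=
  Matrix.mulVecBilin ℍ[ℝ] ℍ[ℝ]ᵐᵒᵖ M

theorem qlin_apply (M : Matrix ι κ ℍ[ℝ]) (v : κ → ℍ[ℝ]) : qlin M v = M *ᵥ v := rfl

theorem qlin_mul (M : Matrix ι κ ℍ[ℝ]) (N : Matrix κ κ' ℍ[ℝ]) :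
    qlin (M * N) = qlin M ∘ₗ qlin N :=
  LinearMap.ext fun v => (Matrix.mulVec_mulVec v M N).symm

theorem qlin_bijective [DecidableEq κ] :
    Function.Bijective (qlin : Matrix ι κ ℍ[ℝ] → (κ → ℍ[ℝ]) →ₗ[ℍ[ℝ]ᵐᵒᵖ] (ι → ℍ[ℝ])) := by
  refine ⟨fun M N h => ?_, fun f => ⟨Matrix.of fun i j => f (Pi.single j 1) i, ?_⟩⟩
  · ext1 i j
    simpa [qlin_apply] using congr($h (Pi.single j 1) i)
  · refine LinearMap.ext fun v => funext fun i => ?_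
    have hv : v = ∑ j, MulOpposite.op (v j) • Pi.single (M := fun _ => ℍ[ℝ]) j 1 := by
      ext1 j
      simp [Finset.sum_apply, Pi.single_apply]
    conv_rhs => rw [hv, map_sum]
    simp [Matrix.mulVec, dotProduct]

instance : FiniteDimensional ℍ[ℝ]ᵐᵒᵖ ℍ[ℝ] :=
  Module.Finite.equiv (MulOpposite.opLinearEquiv ℍ[ℝ]ᵐᵒᵖ (M := ℍ[ℝ])).symm

theorem finrank_quaternion_fun : finrank ℍ[ℝ]ᵐᵒᵖ (κ → ℍ[ℝ]) = Fintype.card κ := by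
  rw [← finrank_fintype_fun_eq_card (R := ℍ[ℝ]ᵐᵒᵖ)]
  exact (LinearEquiv.piCongrRight fun _ => MulOpposite.opLinearEquiv ℍ[ℝ]ᵐᵒᵖ).finrank_eq

theorem qrank_eq_finrank_range (M : Matrix ι κ ℍ[ℝ]) :
    qrank M = finrank ℍ[ℝ]ᵐᵒᵖ (LinearMap.range (qlin M)) := by
  classical
  suffices h : span ℍ[ℝ]ᵐᵒᵖ (Set.range M.col) = LinearMap.range (qlin M) by rw [qrank, h]
  refine le_antisymm (span_le.2 ?_) ?_
  · rintro _ ⟨j, rfl⟩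
    exact ⟨Pi.single j 1, by simp⟩
  · rintro _ ⟨v, rfl⟩
    have : qlin M v = ∑ j, MulOpposite.op (v j) • M.col j := by
      ext1 i
      simp [Matrix.mulVec, dotProduct]
    rw [this]
    exact sum_mem fun j _ => smul_mem _ _ (subset_span ⟨j, rfl⟩)

theorem ker_qlin_fromRows (M : Matrix ι κ ℍ[ℝ]) (N : Matrix ι' κ ℍ[ℝ]) :
    LinearMap.ker (qlin (fromRows M N)) = LinearMap.ker (qlin M) ⊓ LinearMap.ker (qlin N) := by
  ext v
  simp only [LinearMap.mem_ker, qlin_apply, Submodule.mem_inf, fromRows_mulVec]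
  constructor
  · intro h
    exact ⟨funext fun i => congr($h (Sum.inl i)), funext fun i => congr($h (Sum.inr i))⟩
  · rintro ⟨h, h'⟩
    ext1 (i | i) <;> simp [h, h']

theorem range_qlin_fromCols (M : Matrix ι κ ℍ[ℝ]) (N : Matrix ι κ' ℍ[ℝ]) :
    LinearMap.range (qlin (fromCols M N)) =
      LinearMap.range (qlin M) ⊔ LinearMap.range (qlin N) := by
  apply le_antisymm
  · rintro _ ⟨v, rfl⟩
    rw [qlin_apply, fromCols_mulVec]
    exact add_mem (mem_sup_left ⟨_, rfl⟩) (mem_sup_right ⟨_, rfl⟩)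
  · refine sup_le ?_ ?_
    · rintro _ ⟨v, rfl⟩
      exact ⟨Sum.elim v 0, by rw [qlin_apply, qlin_apply, fromCols_mulVec_sumElim]; simp⟩
    · rintro _ ⟨v, rfl⟩
      exact ⟨Sum.elim 0 v, by rw [qlin_apply, qlin_apply, fromCols_mulVec_sumElim]; simp⟩

theorem qrank_add_finrank_ker (M : Matrix ι κ ℍ[ℝ]) :
    qrank M + finrank ℍ[ℝ]ᵐᵒᵖ (LinearMap.ker (qlin M)) = Fintype.card κ := by
  rw [qrank_eq_finrank_range, LinearMap.finrank_range_add_finrank_ker, finrank_quaternion_fun]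

theorem qrank_eq_of_ker_eq {M : Matrix ι κ ℍ[ℝ]} {N : Matrix ι' κ ℍ[ℝ]}
    (h : LinearMap.ker (qlin M) = LinearMap.ker (qlin N)) : qrank M = qrank N := by
  have h1 := qrank_add_finrank_ker M
  have h2 := qrank_add_finrank_ker N
  rw [h] at h1
  omega

theorem qrank_fromRows [Fintype ι] (M : Matrix ι κ ℍ[ℝ]) (N : Matrix ι' κ ℍ[ℝ]) :
    qrank (fromRows M N) = qrank N +
      finrank ℍ[ℝ]ᵐᵒᵖ ((LinearMap.ker (qlin N)).map (qlin M)) := by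
  have h1 := qrank_add_finrank_ker (fromRows M N)
  have h2 := qrank_add_finrank_ker N
  have h3 := finrank_map_add_finrank_inf_ker (qlin M) (LinearMap.ker (qlin N))
  rw [ker_qlin_fromRows, inf_comm] at h1
  omega

/-- Projecting the column space to the lower block gives `im H`; the vectors with zero lower block
project isomorphically onto `A(ker H) + im B`. -/
theorem qrank_fromRows_fromCols_zero [Fintype ι] [Fintype ι'] (A : Matrix ι κ ℍ[ℝ])
    (B : Matrix ι κ' ℍ[ℝ]) (H : Matrix ι' κ ℍ[ℝ]) :
    qrank (fromRows (fromCols A B) (fromCols H 0)) = qrank H +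
      finrank ℍ[ℝ]ᵐᵒᵖ ((LinearMap.ker (qlin H)).map (qlin A) ⊔ LinearMap.range (qlin B) :
        Submodule ℍ[ℝ]ᵐᵒᵖ (ι → ℍ[ℝ])) := by
  set L := qlin (fromRows (fromCols A B) (fromCols H (0 : Matrix ι' κ' ℍ[ℝ])))
  have hL : ∀ v w, L (Sum.elim v w) = Sum.elim (A *ᵥ v + B *ᵥ w) (H *ᵥ v) := fun v w => by
    change _ *ᵥ Sum.elim v w = _
    rw [fromRows_mulVec, fromCols_mulVec_sumElim, fromCols_mulVec_sumElim, zero_mulVec, add_zero]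
  let fl := LinearMap.funLeft ℍ[ℝ]ᵐᵒᵖ ℍ[ℝ] (Sum.inl : ι → ι ⊕ ι')
  let fr := LinearMap.funLeft ℍ[ℝ]ᵐᵒᵖ ℍ[ℝ] (Sum.inr : ι' → ι ⊕ ι')
  have h1 := finrank_map_add_finrank_inf_ker fr (LinearMap.range L)
  have h2 := finrank_map_add_finrank_inf_ker fl (LinearMap.range L ⊓ LinearMap.ker fr)
  have h3 : LinearMap.range L ⊓ LinearMap.ker fr ⊓ LinearMap.ker fl = ⊥ := by
    rw [eq_bot_iff]
    rintro v ⟨⟨-, hr⟩, hl⟩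
    ext1 (i | i)
    · exact congr($hl i)
    · exact congr($hr i)
  have h4 : (LinearMap.range L).map fr = LinearMap.range (qlin H) := by
    ext x
    constructor
    · rintro ⟨_, ⟨v, rfl⟩, rfl⟩
      refine ⟨v ∘ Sum.inl, ?_⟩
      rw [← Sum.elim_comp_inl_inr v, hL]
      rfl
    · rintro ⟨v, rfl⟩
      exact ⟨_, ⟨Sum.elim v 0, rfl⟩, by rw [hL]; rfl⟩
  have h5 : (LinearMap.range L ⊓ LinearMap.ker fr).map fl =
      (LinearMap.ker (qlin H)).map (qlin A) ⊔ LinearMap.range (qlin B) := by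
    apply le_antisymm
    · rintro _ ⟨_, ⟨⟨v, rfl⟩, hv⟩, rfl⟩
      rw [← Sum.elim_comp_inl_inr v, hL] at hv ⊢
      exact add_mem (mem_sup_left ⟨v ∘ Sum.inl, hv, rfl⟩) (mem_sup_right ⟨v ∘ Sum.inr, rfl⟩)
    · refine sup_le ?_ ?_
      · rintro _ ⟨v, hv, rfl⟩
        refine ⟨_, ⟨⟨Sum.elim v 0, rfl⟩, ?_⟩, ?_⟩
        · rw [hL]; exact hv
        · rw [hL, Matrix.mulVec_zero, add_zero]; rfl
      · rintro _ ⟨v, rfl⟩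
        refine ⟨_, ⟨⟨Sum.elim 0 v, rfl⟩, ?_⟩, ?_⟩
        · simp only [hL, Matrix.mulVec_zero]; rfl
        · rw [hL, Matrix.mulVec_zero, zero_add]; rfl
  rw [h3, finrank_bot, h5] at h2
  rw [h4] at h1
  rw [qrank_eq_finrank_range, qrank_eq_finrank_range H]
  change finrank ℍ[ℝ]ᵐᵒᵖ (LinearMap.range L) = _
  omega

theorem row3_zero_zero_eq {ι κ₁ κ₂ κ₃ : Type*} (M : Matrix ι κ₁ ℍ[ℝ]) :
    row3 M (0 : Matrix ι κ₂ ℍ[ℝ]) (0 : Matrix ι κ₃ ℍ[ℝ]) = fromCols M 0 := by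
  rw [row3, fromCols_zero]

theorem fromRows_fromCols_fromCols_zero {ι₁ ι₂ κ₁ κ₂ : Type*} (M : Matrix ι₁ κ₁ ℍ[ℝ])
    (N : Matrix ι₂ κ₁ ℍ[ℝ]) :
    fromRows (fromCols M (0 : Matrix ι₁ κ₂ ℍ[ℝ])) (fromCols N 0) = fromCols (fromRows M N) 0 := by
  ext1 (i | i) (j | j) <;> rfl

end QuaternionMatrix

/-! ### Translation into the rank formulas. -/

section RankFormulas

open Module Submodule Matrix

variable {m n p₁ p₂ p₃ q₁ q₂ q₃ : ℕ}
    {A : Matrix (Fin m) (Fin n) ℍ[ℝ]} {B : Matrix (Fin m) (Fin p₁) ℍ[ℝ]}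
    {C : Matrix (Fin m) (Fin p₂) ℍ[ℝ]} {D : Matrix (Fin m) (Fin p₃) ℍ[ℝ]}
    {E : Matrix (Fin q₁) (Fin n) ℍ[ℝ]} {F : Matrix (Fin q₂) (Fin n) ℍ[ℝ]}
    {G : Matrix (Fin q₃) (Fin n) ℍ[ℝ]}

theorem exists_isSolution_iff (Y : Matrix (Fin p₂) (Fin q₂) ℍ[ℝ]) :
    (∃ X W Z, IsSolution A B C D E F G X W Y Z) ↔
    (∀ v ∈ LinearMap.ker (qlin E) ⊓ LinearMap.ker (qlin G),
      qlin A v - qlin C (qlin Y (qlin F v)) ∈ LinearMap.range (qlin B)) ∧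
    ∀ v ∈ LinearMap.ker (qlin E), qlin A v - qlin C (qlin Y (qlin F v)) ∈
      LinearMap.range (qlin B) ⊔ LinearMap.range (qlin D) := by
  refine Iff.trans ?_ (exists_comp_add_comp_add_comp_eq_iff
    (qlin A - qlin C ∘ₗ qlin Y ∘ₗ qlin F) (qlin B) (qlin D) (qlin E) (qlin G))
  have key : ∀ X W Z, IsSolution A B C D E F G X W Y Z ↔
      qlin B ∘ₗ qlin X + qlin W ∘ₗ qlin E + qlin D ∘ₗ qlin Z ∘ₗ qlin G =
        qlin A - qlin C ∘ₗ qlin Y ∘ₗ qlin F := fun X W Z => by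
    rw [IsSolution, ← qlin_bijective.1.eq_iff, eq_sub_iff_add_eq, add_right_comm,
      Matrix.mul_assoc C, Matrix.mul_assoc D]
    simp only [← qlin_mul, qlin, map_add]
  constructor
  · rintro ⟨X, W, Z, h⟩
    exact ⟨_, _, _, (key X W Z).1 h⟩
  · rintro ⟨X, W, Z, h⟩
    obtain ⟨X, rfl⟩ := qlin_bijective.2 X
    obtain ⟨W, rfl⟩ := qlin_bijective.2 W
    obtain ⟨Z, rfl⟩ := qlin_bijective.2 Z
    exact ⟨X, W, Z, (key X W Z).2 h⟩

theorem exists_isSolution_iff_isCompletion {X₀ W₀ Y₀ Z₀}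
    (h : IsSolution A B C D E F G X₀ W₀ Y₀ Z₀) (Y : Matrix (Fin p₂) (Fin q₂) ℍ[ℝ]) :
    (∃ X W Z, IsSolution A B C D E F G X W Y Z) ↔
    IsCompletion (qlin Y₀)
      ((LinearMap.ker (qlin E) ⊓ LinearMap.ker (qlin G)).map (qlin F))
      ((LinearMap.ker (qlin E)).map (qlin F))
      ((LinearMap.range (qlin B)).comap (qlin C))
      ((LinearMap.range (qlin B) ⊔ LinearMap.range (qlin D)).comap (qlin C)) (qlin Y) := by
  obtain ⟨h₁, h₂⟩ := (exists_isSolution_iff Y₀).1 ⟨X₀, W₀, Z₀, h⟩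
  have key : ∀ (T : Submodule ℍ[ℝ]ᵐᵒᵖ (Fin m → ℍ[ℝ])) (v : Fin n → ℍ[ℝ]),
      qlin A v - qlin C (qlin Y₀ (qlin F v)) ∈ T →
      (qlin A v - qlin C (qlin Y (qlin F v)) ∈ T ↔
        qlin Y (qlin F v) - qlin Y₀ (qlin F v) ∈ T.comap (qlin C)) := fun T v hv => by
    rw [mem_comap, map_sub, ← T.sub_mem_iff_right hv, sub_sub_sub_cancel_left]
  rw [exists_isSolution_iff, IsCompletion]
  refine and_congr ?_ ?_
  · constructor
    · rintro h' _ ⟨v, hv, rfl⟩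
      exact (key _ v (h₁ v hv)).1 (h' v hv)
    · exact fun h' v hv => (key _ v (h₁ v hv)).2 (h' _ ⟨v, hv, rfl⟩)
  · constructor
    · rintro h' _ ⟨v, hv, rfl⟩
      exact (key _ v (h₂ v hv)).1 (h' v hv)
    · exact fun h' v hv => (key _ v (h₂ v hv)).2 (h' _ ⟨v, hv, rfl⟩)

theorem isGreatest_isLeast_ranksY (hcons : ∃ X W Y Z, IsSolution A B C D E F G X W Y Z) :
    IsGreatest (ranksY A B C D E F G)
      (min (min (p₂ : ℤ) (q₂ : ℤ))
        (min
          ((p₂ : ℤ) + q₂ + qrank (stack3 (row2 A B) (row2 E 0) (row2 G 0))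
            - qrank (stack3 E F G) - qrank (row2 B C))
          ((p₂ : ℤ) + q₂ + qrank (stack2 (row3 A B D) (row3 E 0 0))
            - qrank (stack2 E F) - qrank (row3 B C D)))) ∧
    IsLeast (ranksY A B C D E F G)
      ((qrank (stack3 (row2 A B) (row2 E 0) (row2 G 0)) : ℤ)
        + qrank (stack2 (row3 A B D) (row3 E 0 0))
        - qrank (stack3 (row3 A B D) (row3 E 0 0) (row3 G 0 0))
        - qrank B - qrank E) := by
  obtain ⟨X₀, W₀, Y₀, Z₀, h⟩ := hcons
  obtain ⟨hA₁, hA₂⟩ := (exists_isSolution_iff Y₀).1 ⟨X₀, W₀, Z₀, h⟩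
  have hiff := exists_isSolution_iff_isCompletion h
  set S₁ := (LinearMap.ker (qlin E) ⊓ LinearMap.ker (qlin G)).map (qlin F) with hS₁
  set S₂ := (LinearMap.ker (qlin E)).map (qlin F) with hS₂
  set T₁ := (LinearMap.range (qlin B)).comap (qlin C) with hT₁
  set T₂ := (LinearMap.range (qlin B) ⊔ LinearMap.range (qlin D)).comap (qlin C) with hT₂
  have hS : S₁ ≤ S₂ := map_mono inf_le_left
  have hT : T₁ ≤ T₂ := comap_mono le_sup_left
  have hmap : ∀ U : Submodule ℍ[ℝ]ᵐᵒᵖ (Fin n → ℍ[ℝ]),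
      U.map (qlin C ∘ₗ qlin Y₀ ∘ₗ qlin F) = ((U.map (qlin F)).map (qlin Y₀)).map (qlin C) :=
    fun U => by rw [map_comp, map_comp]
  -- In `e₁`, `e₂`, `e₃`, `A` may be replaced by `C Y₀ F`, because the two agree on the relevant
  -- kernel modulo the relevant range.
  have e₁ : qrank (stack3 (row2 A B) (row2 E 0) (row2 G 0)) = qrank (fromRows E G) +
      finrank ℍ[ℝ]ᵐᵒᵖ ((S₁.map (qlin Y₀)).map (qlin C) ⊔ LinearMap.range (qlin B) :
        Submodule ℍ[ℝ]ᵐᵒᵖ _) := by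
    rw [stack3, row2, row2, row2, fromRows_fromCols_fromCols_zero, qrank_fromRows_fromCols_zero, ker_qlin_fromRows, hS₁,
      ← hmap, map_sup_eq_of_forall_sub_mem (Y₀ := qlin C ∘ₗ qlin Y₀ ∘ₗ qlin F) hA₁]
  have e₂ : qrank (stack2 (row3 A B D) (row3 E 0 0)) = qrank E +
      finrank ℍ[ℝ]ᵐᵒᵖ ((S₂.map (qlin Y₀)).map (qlin C) ⊔
        (LinearMap.range (qlin B) ⊔ LinearMap.range (qlin D)) : Submodule ℍ[ℝ]ᵐᵒᵖ _) := by
    rw [stack2, row3_zero_zero_eq, row3, qrank_fromRows_fromCols_zero, range_qlin_fromCols, hS₂,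
      ← hmap, map_sup_eq_of_forall_sub_mem (Y₀ := qlin C ∘ₗ qlin Y₀ ∘ₗ qlin F) hA₂]
  have e₃ : qrank (stack3 (row3 A B D) (row3 E 0 0) (row3 G 0 0)) = qrank (fromRows E G) +
      finrank ℍ[ℝ]ᵐᵒᵖ ((S₁.map (qlin Y₀)).map (qlin C) ⊔
        (LinearMap.range (qlin B) ⊔ LinearMap.range (qlin D)) : Submodule ℍ[ℝ]ᵐᵒᵖ _) := by
    rw [stack3, row3_zero_zero_eq, row3_zero_zero_eq, row3, fromRows_fromCols_fromCols_zero,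
      qrank_fromRows_fromCols_zero, range_qlin_fromCols, ker_qlin_fromRows, hS₁,
      ← hmap, map_sup_eq_of_forall_sub_mem (Y₀ := qlin C ∘ₗ qlin Y₀ ∘ₗ qlin F)
        (S := LinearMap.ker (qlin E) ⊓ LinearMap.ker (qlin G)) fun v hv => hA₂ v hv.1]
  have e₄ : qrank (stack3 E F G) = qrank (fromRows E G) + finrank ℍ[ℝ]ᵐᵒᵖ S₁ := by
    rw [hS₁, ← ker_qlin_fromRows, ← qrank_fromRows]
    apply qrank_eq_of_ker_eq
    simp only [ker_qlin_fromRows]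
    ac_rfl
  have e₅ : qrank (stack2 E F) = qrank E + finrank ℍ[ℝ]ᵐᵒᵖ S₂ := by
    rw [hS₂, ← qrank_fromRows]
    apply qrank_eq_of_ker_eq
    simp only [ker_qlin_fromRows]
    ac_rfl
  have f₁ := finrank_map_sup_add_finrank_comap (qlin C) (S₁.map (qlin Y₀)) (LinearMap.range (qlin B))
  have f₂ := finrank_map_sup_add_finrank_comap (qlin C) (S₂.map (qlin Y₀))
    (LinearMap.range (qlin B) ⊔ LinearMap.range (qlin D))
  have f₃ := finrank_map_sup_add_finrank_comap (qlin C) (S₁.map (qlin Y₀))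
    (LinearMap.range (qlin B) ⊔ LinearMap.range (qlin D))
  -- Taking the whole space as `S` relates `dim T₁` to `r(B, C)`, and in `f₅` `dim T₂` to `r(B, C,
  -- D)`.
  have f₄ := finrank_map_sup_add_finrank_comap (qlin C) ⊤ (LinearMap.range (qlin B))
  have f₅ := finrank_map_sup_add_finrank_comap (qlin C) ⊤
    (LinearMap.range (qlin B) ⊔ LinearMap.range (qlin D))
  rw [top_sup_eq, finrank_top, finrank_quaternion_fun, Fintype.card_fin, ← LinearMap.range_eq_map,
    sup_comm, ← range_qlin_fromCols, ← qrank_eq_finrank_range] at f₄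
  rw [top_sup_eq, finrank_top, finrank_quaternion_fun, Fintype.card_fin, ← LinearMap.range_eq_map,
    sup_left_comm, ← range_qlin_fromCols C D, ← range_qlin_fromCols,
    ← qrank_eq_finrank_range] at f₅
  change qrank (row2 B C) + _ = _ at f₄
  change qrank (row3 B C D) + _ = _ at f₅
  rw [← hT₁] at f₁ f₄
  rw [← hT₂] at f₂ f₃ f₅
  rw [← qrank_eq_finrank_range] at f₁ f₄
  have hV : finrank ℍ[ℝ]ᵐᵒᵖ (Fin q₂ → ℍ[ℝ]) = q₂ := by simp [finrank_quaternion_fun]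
  have hW : finrank ℍ[ℝ]ᵐᵒᵖ (Fin p₂ → ℍ[ℝ]) = p₂ := by simp [finrank_quaternion_fun]
  have hmem : ∀ Y' : (Fin q₂ → ℍ[ℝ]) →ₗ[ℍ[ℝ]ᵐᵒᵖ] (Fin p₂ → ℍ[ℝ]),
      IsCompletion (qlin Y₀) S₁ S₂ T₁ T₂ Y' →
      (finrank ℍ[ℝ]ᵐᵒᵖ (LinearMap.range Y') : ℤ) ∈ ranksY A B C D E F G := fun Y' hY' => by
    obtain ⟨Y, rfl⟩ := qlin_bijective.2 Y'
    obtain ⟨X, W, Z, hs⟩ := (hiff Y).2 hY'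
    exact ⟨X, W, Y, Z, hs, by rw [qrank_eq_finrank_range]⟩
  have hrank : ∀ r ∈ ranksY A B C D E F G, ∃ Y, IsCompletion (qlin Y₀) S₁ S₂ T₁ T₂ Y ∧
      r = finrank ℍ[ℝ]ᵐᵒᵖ (LinearMap.range Y) := by
    rintro _ ⟨X, W, Y, Z, hs, rfl⟩
    exact ⟨qlin Y, (hiff Y).1 ⟨X, W, Z, hs⟩, by rw [qrank_eq_finrank_range]⟩
  have hle : ∀ Y, IsCompletion (qlin Y₀) S₁ S₂ T₁ T₂ Y → _ := fun Y hY =>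
    And.intro (LinearMap.finrank_range_le Y) (And.intro (Submodule.finrank_le (LinearMap.range Y))
      (And.intro (finrank_range_add_le_of_forall_sub_mem hY.1)
        (finrank_range_add_le_of_forall_sub_mem hY.2)))
  rw [hV, hW] at hle
  rw [e₁, e₂, e₃, e₄, e₅]
  refine ⟨⟨?_, ?_⟩, ?_, ?_⟩
  · obtain ⟨Y, hY⟩ := exists_isMaxCompletion (qlin Y₀) S₁ S₂ T₁ T₂
    have h1 := hY.finrank_range_cases hS hT
    have h2 := hle Y hY.1
    convert hmem Y hY.1 using 1
    rw [hV, hW] at h1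
    omega
  · intro r hr
    obtain ⟨Y, hY, rfl⟩ := hrank r hr
    have h2 := hle Y hY
    omega
  · obtain ⟨Y, hY, h1⟩ := exists_isCompletion_finrank_range_le (qlin Y₀) hS hT
    have h2 := hY.add_le_finrank_range hS
    convert hmem Y hY using 1
    omega
  · intro r hr
    obtain ⟨Y, hY, rfl⟩ := hrank r hr
    have h2 := hY.add_le_finrank_range hS
    omega

theorem isSolution_swap_iff {X W Y Z} :
    IsSolution A B D C E G F X W Z Y ↔ IsSolution A B C D E F G X W Y Z := by
  rw [IsSolution, IsSolution, add_right_comm]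

theorem ranksY_swap : ranksY A B D C E G F = ranksZ A B C D E F G := by
  ext r
  constructor
  · rintro ⟨X, W, Y, Z, h, hr⟩
    exact ⟨X, W, Z, Y, isSolution_swap_iff.1 h, hr⟩
  · rintro ⟨X, W, Y, Z, h, hr⟩
    exact ⟨X, W, Z, Y, isSolution_swap_iff.2 h, hr⟩

end RankFormulas

theorem theorem3p13 {m n p₁ p₂ p₃ q₁ q₂ q₃ : ℕ}
    (A : Matrix (Fin m) (Fin n) ℍ[ℝ]) (B : Matrix (Fin m) (Fin p₁) ℍ[ℝ])
    (C : Matrix (Fin m) (Fin p₂) ℍ[ℝ]) (D : Matrix (Fin m) (Fin p₃) ℍ[ℝ])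
    (E : Matrix (Fin q₁) (Fin n) ℍ[ℝ]) (F : Matrix (Fin q₂) (Fin n) ℍ[ℝ])
    (G : Matrix (Fin q₃) (Fin n) ℍ[ℝ])
    (hcons : ∃ X W Y Z, IsSolution A B C D E F G X W Y Z) :
    IsGreatest (ranksY A B C D E F G)
      (min (min (p₂ : ℤ) (q₂ : ℤ))
        (min
          ((p₂ : ℤ) + q₂ + qrank (stack3 (row2 A B) (row2 E 0) (row2 G 0))
            - qrank (stack3 E F G) - qrank (row2 B C))
          ((p₂ : ℤ) + q₂ + qrank (stack2 (row3 A B D) (row3 E 0 0))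
            - qrank (stack2 E F) - qrank (row3 B C D)))) ∧
    IsLeast (ranksY A B C D E F G)
      ((qrank (stack3 (row2 A B) (row2 E 0) (row2 G 0)) : ℤ)
        + qrank (stack2 (row3 A B D) (row3 E 0 0))
        - qrank (stack3 (row3 A B D) (row3 E 0 0) (row3 G 0 0))
        - qrank B - qrank E) ∧
    IsGreatest (ranksZ A B C D E F G)
      (min (min (p₃ : ℤ) (q₃ : ℤ))
        (min
          ((p₃ : ℤ) + q₃ + qrank (stack3 (row2 A B) (row2 E 0) (row2 F 0))
            - qrank (stack3 E F G) - qrank (row2 B D))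
          ((p₃ : ℤ) + q₃ + qrank (stack2 (row3 A B C) (row3 E 0 0))
            - qrank (stack2 E G) - qrank (row3 B C D)))) ∧
    IsLeast (ranksZ A B C D E F G)
      ((qrank (stack3 (row2 A B) (row2 E 0) (row2 F 0)) : ℤ)
        + qrank (stack2 (row3 A B C) (row3 E 0 0))
        - qrank (stack3 (row3 A B C) (row3 E 0 0) (row3 F 0 0))
        - qrank B - qrank E) := by
  refine ⟨(isGreatest_isLeast_ranksY hcons).1, (isGreatest_isLeast_ranksY hcons).2, ?_⟩
  obtain ⟨X, W, Y, Z, h⟩ := hcons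
  have hstack : qrank (stack3 E G F) = qrank (stack3 E F G) := by
    apply qrank_eq_of_ker_eq
    simp only [ker_qlin_fromRows]
    ac_rfl
  have hrow : qrank (row3 B D C) = qrank (row3 B C D) := by
    rw [qrank_eq_finrank_range, qrank_eq_finrank_range, row3, row3, range_qlin_fromCols,
      range_qlin_fromCols, range_qlin_fromCols, range_qlin_fromCols, sup_comm (LinearMap.range (qlin D))]
  -- Exchanging `(C, Y, F)` with `(D, Z, G)` preserves the equation and only permutes the blocks in
  -- the two ranks treated above.
  have := isGreatest_isLeast_ranksY ⟨X, W, Z, Y, isSolution_swap_iff.2 h⟩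
  rwa [ranksY_swap, hstack, hrow] at this
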